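/- Let $G$ be a connected finite simple graph of order $n$, let $L(G)=\mathrm{Deg}(G)-A(G)$ be its Laplacian matrix (degree matrix minus adjacency matrix), and let $\tau(G)$ be the number of spanning trees of $G$. (i) If $n$ is odd and $\tau(G)=2^t s$ with $t\ge 0$ and $s$ odd, then $L(G)$ has no nonzero integer eigenvalue $\lambda$ with $2^{\max(1,t)}\mid\lambda$. (ii) If $L(G)$ has an integer eigenvalue $\lambda=2^t s$, with $t\ge 1$ and $s$ odd, of multiplicity at least $2$, then $2^{t+1}$ divides $\tau(G)$. -/

import Mathlib

/-- The number `τ(G)` of spanning trees of a graph `G`: the number of trees on the whole vertex set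
of `G` all of whose edges are edges of `G`. -/
noncomputable def SimpleGraph.numSpanningTrees {V : Type*} (G : SimpleGraph V) : ℕ :=
  {T : SimpleGraph V | T ≤ G ∧ T.IsTree}.ncard

/-- The Laplacian matrix `L(G)`, acting on `ℝ^V`. -/
noncomputable def SimpleGraph.laplacianEnd {V : Type*} [Fintype V] [DecidableEq V]
    (G : SimpleGraph V) [DecidableRel G.Adj] : Module.End ℝ (V → ℝ) :=
  Matrix.toLin' (G.lapMatrix ℝ)

/-! By the matrix-tree theorem `τ(G)` is the determinant of `L` with the row and column of `v`
deleted. If an integer vector `z` with an odd entry has `z v = 0` and `L z = 2^t w`, Cramer's rule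
gives `2^t ∣ τ(G)`, and `w ⬝ᵥ z` even gains one more factor 2
(`Matrix.IsSymm.two_pow_succ_dvd_det`). An integer eigenvector `y` for a nonzero eigenvalue has
entry sum 0, so `y ⬝ᵥ y` is even. For (i), `z` is `y` minus the constant `y v`; as `n` is odd it
keeps an odd entry, and the resulting divisibility contradicts the parity of `s`. For (ii),
multiplicity 2 allows `y v = 0`, and `z = y`. -/

open Matrix

/-! ### Spanning trees as parent maps towards a root -/

namespace SimpleGraph

variable {V : Type*}

/-- The graph that joins every vertex to its image under `g`. -/
def parentGraph (g : V → V) : SimpleGraph V :=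
  fromRel fun a b => g a = b

theorem parentGraph_adj {g : V → V} {a b : V} :
    (parentGraph g).Adj a b ↔ a ≠ b ∧ (g a = b ∨ g b = a) :=
  fromRel_adj _ a b

theorem parentGraph_reachable_iterate (g : V → V) (u : V) (k : ℕ) :
    (parentGraph g).Reachable u (g^[k] u) := by
  induction k with
  | zero => exact Reachable.refl _
  | succ k ih =>
    rw [Function.iterate_succ_apply']
    by_cases h : g^[k] u = g (g^[k] u)
    · rwa [← h]
    · exact ih.trans (Adj.reachable (parentGraph_adj.2 ⟨h, Or.inl rfl⟩))

theorem parentGraph_connected {g : V → V} {v : V} (hr : ∀ u, ∃ k, g^[k] u = v) :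
    (parentGraph g).Connected := by
  have h (u : V) : (parentGraph g).Reachable u v := by
    obtain ⟨k, hk⟩ := hr u
    exact hk ▸ parentGraph_reachable_iterate g u k
  exact (connected_iff_exists_forall_reachable _).2 ⟨v, fun u => (h u).symm⟩

theorem parentGraph_isTree [Finite V] {g : V → V} {v : V} (hv : g v = v)
    (hr : ∀ u, ∃ k, g^[k] u = v) : (parentGraph g).IsTree := by
  classical
  have := Fintype.ofFinite V
  have hc := parentGraph_connected hr
  refine isTree_iff_connected_and_card.2 ⟨hc, le_antisymm ?_ hc.card_vert_le_card_edgeSet_add_one⟩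
  have hsub : (parentGraph g).edgeSet ⊆
      ((Finset.univ.erase v).image fun u => s(u, g u) : Finset (Sym2 V)) := by
    intro e
    induction e using Sym2.ind with
    | _ a b =>
      intro he
      obtain ⟨hab, h | h⟩ := parentGraph_adj.1 he
      · simp only [Finset.coe_image, Set.mem_image, Finset.mem_coe]
        refine ⟨a, by simp; rintro rfl; exact hab (hv.symm.trans h), by rw [h]⟩
      · simp only [Finset.coe_image, Set.mem_image, Finset.mem_coe]
        refine ⟨b, by simp; rintro rfl; exact hab (h.symm.trans hv), by rw [h, Sym2.eq_swap]⟩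
  have h1 := Set.ncard_le_ncard hsub (Finset.finite_toSet _)
  rw [Set.ncard_coe_finset] at h1
  have h2 := h1.trans Finset.card_image_le
  rw [Finset.card_erase_of_mem (Finset.mem_univ v), Finset.card_univ] at h2
  rw [Nat.card_coe_set_eq, Nat.card_eq_fintype_card]
  have : 0 < Fintype.card V := Fintype.card_pos_iff.2 ⟨v⟩
  omega

/-- Induct on the distance to the root along `g`: if `g'` does not send `u` to `g u`, it sends `g u`
to `u`, hence so does `g`, and this 2-cycle never reaches `v`. -/
theorem parentGraph_injOn {g g' : V → V} {v : V} (hv : g v = v) (hv' : g' v = v)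
    (hr : ∀ u, ∃ k, g^[k] u = v) (h : parentGraph g = parentGraph g') : g = g' := by
  have key (k : ℕ) : ∀ u, g^[k] u = v → g u = g' u := by
    induction k with
    | zero => rintro u rfl; exact hv.trans hv'.symm
    | succ k ih =>
      intro u hu
      by_cases huv : u = v
      · rw [huv, hv, hv']
      have hw := ih (g u) hu
      have hne : u ≠ g u := by
        intro e
        refine huv ?_
        rwa [Function.iterate_fixed e.symm] at hu
      have hadj : (parentGraph g').Adj u (g u) := h ▸ parentGraph_adj.2 ⟨hne, Or.inl rfl⟩
      obtain ⟨-, h1 | h1⟩ := parentGraph_adj.1 hadj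
      · exact h1.symm
      · exfalso
        have h2 : g (g u) = u := hw.trans h1
        have h3 (m : ℕ) : g^[m] u = u ∨ g^[m] u = g u := by
          induction m with
          | zero => exact Or.inl rfl
          | succ m ihm =>
            rw [Function.iterate_succ_apply']
            rcases ihm with e | e <;> rw [e]
            · exact Or.inr rfl
            · exact Or.inl h2
        rcases h3 (k + 1) with e | e
        · exact huv (e.symm.trans hu)
        · rw [hu] at e
          rw [← e, hv] at h2
          exact huv h2.symm
  funext u
  obtain ⟨k, hk⟩ := hr u
  exact key k u hk

/-- The parent is a neighbour nearer to `v`; equality follows since a tree is minimal among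
connected graphs. -/
theorem IsTree.exists_parentGraph_eq {T : SimpleGraph V} (hT : T.IsTree) (v : V) :
    ∃ g : V → V, g v = v ∧ (∀ u, ∃ k, g^[k] u = v) ∧ parentGraph g = T := by
  classical
  have hex (u : V) (hu : u ≠ v) : ∃ w, T.Adj u w ∧ T.dist w v < T.dist u v := by
    obtain ⟨p, hp⟩ := hT.connected.exists_walk_length_eq_dist u v
    cases p with
    | nil => exact absurd rfl hu
    | cons ha q =>
      refine ⟨_, ha, ?_⟩
      rw [← hp, Walk.length_cons]
      exact Nat.lt_succ_of_le (dist_le q)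
  choose! f hadj hlt using hex
  let g : V → V := fun u => if u = v then v else f u
  have hg (u : V) (hu : u ≠ v) : g u = f u := if_neg hu
  have hgv : g v = v := if_pos rfl
  have hr (n : ℕ) : ∀ u, T.dist u v = n → ∃ k, g^[k] u = v := by
    induction n using Nat.strong_induction_on with
    | _ n ih =>
      intro u hu
      by_cases huv : u = v
      · exact ⟨0, huv⟩
      · obtain ⟨k, hk⟩ := ih _ (hu ▸ hlt u huv) (f u) rfl
        exact ⟨k + 1, by rw [Function.iterate_succ_apply, hg u huv, hk]⟩
  have hr' (u : V) : ∃ k, g^[k] u = v := hr _ u rfl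
  have hle' (a b : V) (hab : a ≠ b) (h : g a = b) : T.Adj a b := by
    have ha : a ≠ v := by
      rintro rfl
      exact hab (hgv.symm.trans h)
    rw [← h, hg a ha]
    exact hadj a ha
  refine ⟨g, hgv, hr', ?_⟩
  have hle : parentGraph g ≤ T := by
    intro a b hab
    obtain ⟨hne, h | h⟩ := parentGraph_adj.1 hab
    · exact hle' a b hne h
    · exact (hle' b a hne.symm h).symm
  exact (isTree_iff_minimal_connected.1 hT).eq_of_le (parentGraph_connected hr') hle

end SimpleGraph

/-! ### Determinants attached to parent maps -/

/-- The matrix of a self-map `g` of `V`, with the row and column of `v` deleted. -/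
def reducedMapMatrix {V : Type*} [DecidableEq V] (v : V) (g : V → V) :
    Matrix {u // u ≠ v} {u // u ≠ v} ℤ :=
  Matrix.of fun i j => if g i = j then 1 else 0

theorem reducedMapMatrix_mulVec {V : Type*} [Fintype V] [DecidableEq V] {v : V} {g : V → V}
    {f : V → ℤ} (hf : f v = 0) (i : {u // u ≠ v}) :
    (reducedMapMatrix v g *ᵥ fun j => f j) i = f (g i) := by
  simp only [reducedMapMatrix, Matrix.mulVec, dotProduct, Matrix.of_apply]
  by_cases h : g i = v
  · rw [h, hf]
    exact Finset.sum_eq_zero fun x _ => by rw [if_neg x.2.symm, zero_mul]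
  · rw [Finset.sum_eq_single ⟨g i, h⟩]
    · simp
    · intro b _ hb
      rw [if_neg (fun e => hb (Subtype.ext e.symm)), zero_mul]
    · simp

theorem reducedMapMatrix_pow_mulVec {V : Type*} [Fintype V] [DecidableEq V] {v : V} {g : V → V}
    (hv : g v = v) {f : V → ℤ} (hf : f v = 0) (k : ℕ) (i : {u // u ≠ v}) :
    (reducedMapMatrix v g ^ k *ᵥ fun j => f j) i = f (g^[k] i) := by
  induction k generalizing i f with
  | zero => simp
  | succ k ih =>
    have h : (reducedMapMatrix v g *ᵥ fun j => f j) = fun j : {u // u ≠ v} => f (g j) :=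
      funext fun j => reducedMapMatrix_mulVec hf j
    rw [pow_succ, ← Matrix.mulVec_mulVec, h, ih (f := fun j => f (g j)) (by rw [hv, hf]),
      Function.iterate_succ_apply']

theorem Matrix.det_one_sub_of_isNilpotent {n : Type*} [Fintype n] [DecidableEq n]
    {R : Type*} [CommRing R] [IsDomain R] {M : Matrix n n R} (hM : IsNilpotent M) :
    (1 - M).det = 1 := by
  have h := sub_eq_zero.1 (Matrix.isNilpotent_charpoly_sub_pow_of_isNilpotent hM).eq_zero
  have h2 := congrArg (Polynomial.eval 1) h
  rw [Matrix.eval_charpoly] at h2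
  simpa using h2

theorem det_one_sub_reducedMapMatrix_of_reaches {V : Type*} [Fintype V] [DecidableEq V] {v : V} {g : V → V}
    (hv : g v = v) (hr : ∀ u, ∃ k, g^[k] u = v) : (1 - reducedMapMatrix v g).det = 1 := by
  refine Matrix.det_one_sub_of_isNilpotent ?_
  choose k hk using hr
  -- The sum bounds every `k u`, so this iterate sends all vertices to `v`.
  refine ⟨∑ u, k u, ?_⟩
  refine Matrix.ext_of_mulVec_single fun j => ?_
  ext i
  have hs : (Pi.single j 1 : {u // u ≠ v} → ℤ) =
      fun i => (Pi.single j.1 1 : V → ℤ) i.1 := by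
    ext i
    simp [Pi.single_apply, Subtype.ext_iff]
  rw [hs, reducedMapMatrix_pow_mulVec hv (by simp [j.2.symm])]
  obtain ⟨m, hm⟩ := Nat.exists_eq_add_of_le' (Finset.single_le_sum
    (fun u _ => Nat.zero_le (k u)) (Finset.mem_univ i.1))
  rw [hm, Function.iterate_add_apply, hk, Function.iterate_fixed hv]
  simp [j.2.symm]

/-- The indicator of the vertices that never reach `v` is a nonzero kernel vector. -/
theorem det_one_sub_reducedMapMatrix_of_not_reaches {V : Type*} [Fintype V] [DecidableEq V] {v : V}
    {g : V → V} (hr : ¬ ∀ u, ∃ k, g^[k] u = v) : (1 - reducedMapMatrix v g).det = 0 := by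
  classical
  push Not at hr
  obtain ⟨u₀, hu₀⟩ := hr
  let S : V → Prop := fun u => ∀ k, g^[k] u ≠ v
  have hS (u : V) (hu : u ≠ v) : S (g u) ↔ S u := by
    refine ⟨fun h k => ?_, fun h k => h (k + 1)⟩
    cases k with
    | zero => exact hu
    | succ k => exact h k
  rw [← Matrix.exists_mulVec_eq_zero_iff]
  refine ⟨fun i => if S i then 1 else 0, ?_, ?_⟩
  · intro h
    have := congrFun h ⟨u₀, hu₀ 0⟩
    simp [S, hu₀] at this
  · ext i
    rw [Matrix.sub_mulVec, Matrix.one_mulVec, Pi.sub_apply,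
      reducedMapMatrix_mulVec (f := fun u => if S u then 1 else 0) (if_neg fun h => h 0 rfl)]
    simp [hS i i.2]

/-! ### Matrix-tree theorem -/

namespace SimpleGraph

variable {V : Type*}

theorem lapMatrix_submatrix_row [Fintype V] [DecidableEq V] (G : SimpleGraph V)
    [DecidableRel G.Adj] (v : V) :
    (G.lapMatrix ℤ).submatrix ((↑) : {u // u ≠ v} → V) ((↑) : {u // u ≠ v} → V) =
      Matrix.of fun i : {u // u ≠ v} => ∑ w ∈ G.neighborFinset i,
        fun j : {u // u ≠ v} => (1 : Matrix {u // u ≠ v} {u // u ≠ v} ℤ) i j - if w = j then 1 else 0 := by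
  ext i j
  simp only [lapMatrix, degMatrix, Matrix.submatrix_apply, Matrix.sub_apply, Matrix.of_apply,
    Finset.sum_apply, Finset.sum_sub_distrib, Finset.sum_const, card_neighborFinset_eq_degree,
    Finset.sum_ite_eq', mem_neighborFinset, adjMatrix_apply, Matrix.diagonal_apply,
    Matrix.one_apply, Subtype.ext_iff]
  simp

/-- Extend `r` to a self-map fixing `v`. -/
def rootedMap [DecidableEq V] (v : V) (r : {u // u ≠ v} → V) : V → V :=
  fun u => if h : u = v then v else r ⟨u, h⟩

theorem rootedMap_root [DecidableEq V] (v : V) (r : {u // u ≠ v} → V) : rootedMap v r v = v :=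
  dif_pos rfl

theorem rootedMap_coe [DecidableEq V] (v : V) (r : {u // u ≠ v} → V) (u : {u // u ≠ v}) :
    rootedMap v r u = r u :=
  dif_neg u.2

/-- The matrix-tree theorem. -/
theorem det_reduced_lapMatrix [Fintype V] [DecidableEq V] (G : SimpleGraph V)
    [DecidableRel G.Adj] (v : V) :
    ((G.lapMatrix ℤ).submatrix ((↑) : {u // u ≠ v} → V) ((↑) : {u // u ≠ v} → V)).det =
      G.numSpanningTrees := by
  classical
  have hdet (r : {u // u ≠ v} → V) :
      (Matrix.detRowAlternating fun i : {u // u ≠ v} => fun j : {u // u ≠ v} =>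
        (1 : Matrix {u // u ≠ v} {u // u ≠ v} ℤ) i j - if r i = j then 1 else 0) =
      if ∀ u, ∃ k, (rootedMap v r)^[k] u = v then (1 : ℤ) else 0 := by
    have e : (fun i : {u // u ≠ v} => fun j : {u // u ≠ v} =>
        (1 : Matrix {u // u ≠ v} {u // u ≠ v} ℤ) i j - if r i = j then 1 else 0) =
        (1 - reducedMapMatrix v (rootedMap v r) : Matrix _ _ ℤ) := by
      funext i j
      simp only [reducedMapMatrix, Matrix.sub_apply, Matrix.of_apply, rootedMap_coe]
    rw [e]
    split_ifs with h
    · exact det_one_sub_reducedMapMatrix_of_reaches (rootedMap_root v r) h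
    · exact det_one_sub_reducedMapMatrix_of_not_reaches h
  rw [lapMatrix_submatrix_row]
  -- Multilinearity turns the determinant into a sum over choices of a neighbour for each `u ≠ v`.
  have hsum := (Matrix.detRowAlternating (n := {u // u ≠ v}) (R := ℤ)).toMultilinearMap.map_sum_finset
    (fun i (w : V) => fun j : {u // u ≠ v} => (1 : Matrix {u // u ≠ v} {u // u ≠ v} ℤ) i j - if w = j then 1 else 0)
    (fun i => G.neighborFinset i)
  refine hsum.trans ((Finset.sum_congr rfl fun r _ => hdet r).trans ?_)
  rw [Finset.sum_boole, Nat.cast_inj, numSpanningTrees, ← Set.ncard_coe_finset]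
  refine Set.ncard_congr (fun r _ => parentGraph (rootedMap v r)) ?_ ?_ ?_
  · intro r hr
    simp only [Finset.coe_filter, Fintype.mem_piFinset, mem_neighborFinset, Set.mem_ofPred_eq] at hr
    refine ⟨?_, parentGraph_isTree (rootedMap_root v r) hr.2⟩
    have key (a b : V) (hab : a ≠ b) (h : rootedMap v r a = b) : G.Adj a b := by
      have ha : a ≠ v := by
        rintro rfl
        exact hab ((rootedMap_root _ _).symm.trans h)
      rw [← h, rootedMap_coe v r ⟨a, ha⟩]
      exact hr.1 ⟨a, ha⟩
    intro a b hab
    obtain ⟨hne, h | h⟩ := parentGraph_adj.1 hab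
    · exact key a b hne h
    · exact (key b a hne.symm h).symm
  · intro r r' hr hr' h
    simp only [Finset.coe_filter, Fintype.mem_piFinset, mem_neighborFinset, Set.mem_ofPred_eq] at hr
    have := parentGraph_injOn (rootedMap_root v r) (rootedMap_root v r') hr.2 h
    funext u
    rw [← rootedMap_coe v r, this, rootedMap_coe]
  · rintro T ⟨hTG, hT⟩
    obtain ⟨g, hgv, hr, rfl⟩ := hT.exists_parentGraph_eq v
    have hg : rootedMap v (fun u => g u) = g := by
      funext u
      by_cases h : u = v
      · rw [h, rootedMap_root, hgv]
      · exact rootedMap_coe v _ ⟨u, h⟩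
    refine ⟨fun u => g u, ?_, by rw [hg]⟩
    simp only [Finset.coe_filter, Fintype.mem_piFinset, mem_neighborFinset, Set.mem_ofPred_eq]
    rw [hg]
    refine ⟨fun u => hTG (parentGraph_adj.2 ⟨fun e => u.2 ?_, Or.inl rfl⟩), hr⟩
    obtain ⟨k, hk⟩ := hr u
    rwa [Function.iterate_fixed e.symm] at hk

end SimpleGraph

/-! ### Divisibility of determinants and integer eigenvectors -/

/-- A symmetric integer matrix which maps a vector `z` with an odd entry to `2 ^ t • w`, with
`t ≥ 1` and `w ⬝ᵥ z` even, has determinant divisible by `2 ^ (t + 1)`. -/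
theorem Matrix.IsSymm.two_pow_succ_dvd_det {n : Type*} [Fintype n] [DecidableEq n]
    {A : Matrix n n ℤ} (hA : A.IsSymm) {z w : n → ℤ} {t : ℕ} (ht : 1 ≤ t)
    (hz : A *ᵥ z = (2 : ℤ) ^ t • w) {i : n} (hi : Odd (z i)) (hwz : Even (w ⬝ᵥ z)) :
    (2 : ℤ) ^ (t + 1) ∣ A.det := by
  have h1 : A.det * z i = 2 ^ t * (A.updateCol i w).det := by
    have h := congrFun (congrArg (A.adjugate *ᵥ ·) hz) i
    simp only [Matrix.mulVec_mulVec, Matrix.adjugate_mul, Matrix.smul_mulVec, Matrix.one_mulVec,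
      Matrix.mulVec_smul, ← Matrix.cramer_eq_adjugate_mulVec, Pi.smul_apply, smul_eq_mul,
      Matrix.cramer_apply] at h
    exact h
  have h2 : (2 : ℤ) ∣ (A.updateCol i w).det := by
    set B := A.updateCol i w with hB
    -- Modulo 2, `z` is a left null vector of `B`: symmetry handles the columns of `A`, and `w ⬝ᵥ z`
    -- the new one.
    have hrow (j : n) : (2 : ℤ) ∣ (z ᵥ* B) j := by
      by_cases hj : j = i
      · have : (z ᵥ* B) j = w ⬝ᵥ z := by
          simp [Matrix.vecMul, dotProduct, hB, hj, mul_comm]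
        rw [this]
        exact hwz.two_dvd
      · have : (z ᵥ* B) j = (A *ᵥ z) j := by
          rw [← Matrix.vecMul_transpose, hA]
          simp [Matrix.vecMul, dotProduct, hB, hj]
        rw [this, hz]
        exact (dvd_pow_self 2 (by omega)).mul_right _
    have h := congrFun (Matrix.vecMul_vecMul z B B.adjugate) i
    rw [Matrix.mul_adjugate, Matrix.vecMul_smul, Matrix.vecMul_one, Pi.smul_apply,
      smul_eq_mul] at h
    have h3 : (2 : ℤ) ∣ B.det * z i := by
      rw [← h]
      exact Finset.dvd_sum fun j _ => (hrow j).mul_right _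
    exact (Int.isCoprime_two_left.2 hi).dvd_of_dvd_mul_right h3
  have h3 : (2 : ℤ) ^ (t + 1) ∣ A.det * z i := by
    rw [h1, pow_succ]
    exact mul_dvd_mul_left _ h2
  exact (IsCoprime.pow_left (Int.isCoprime_two_left.2 hi)).dvd_of_dvd_mul_right h3

/-- The Gram matrix `Mᵀ * M` is square with the same kernel, and its integer determinant vanishes
over `ℝ`. -/
theorem Matrix.exists_int_mulVec_eq_zero {m n : Type*} [Fintype m] [Fintype n]
    (M : Matrix m n ℤ) {x : n → ℝ} (hx : x ≠ 0) (h : M.map (Int.cast : ℤ → ℝ) *ᵥ x = 0) :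
    ∃ y : n → ℤ, y ≠ 0 ∧ M *ᵥ y = 0 := by
  classical
  have hdet : (Mᵀ * M).det = 0 := by
    have h0 : ((Int.castRingHom ℝ).mapMatrix (Mᵀ * M)).det = 0 := by
      refine Matrix.exists_mulVec_eq_zero_iff.1 ⟨x, hx, ?_⟩
      rw [RingHom.mapMatrix_apply, Matrix.map_mul, ← Matrix.mulVec_mulVec]
      simp [h]
    rw [← RingHom.map_det] at h0
    simpa using h0
  obtain ⟨y, hy, hy0⟩ := Matrix.exists_mulVec_eq_zero_iff.2 hdet
  refine ⟨y, hy, dotProduct_self_eq_zero.1 ?_⟩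
  rw [Matrix.dotProduct_mulVec, ← Matrix.mulVec_transpose, Matrix.mulVec_mulVec, hy0,
    zero_dotProduct]

theorem exists_odd_primitive {n : Type*} [Fintype n] {y : n → ℤ} (hy : y ≠ 0) :
    ∃ (c : ℤ) (x : n → ℤ), c ≠ 0 ∧ y = c • x ∧ ∃ i, Odd (x i) := by
  obtain ⟨i, hi⟩ := Function.ne_iff.1 hy
  obtain ⟨x, hx, hgcd⟩ := Finset.univ.extract_gcd y ⟨i, Finset.mem_univ i⟩
  refine ⟨Finset.univ.gcd y, x, ?_, funext fun j => hx j (Finset.mem_univ j), ?_⟩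
  · intro h
    exact hi (Finset.gcd_eq_zero_iff.1 h i (Finset.mem_univ i))
  · by_contra! hodd
    have h2 : (2 : ℤ) ∣ Finset.univ.gcd x :=
      Finset.dvd_gcd fun j _ => (Int.not_odd_iff_even.1 (hodd j)).two_dvd
    rw [hgcd] at h2
    omega

namespace SimpleGraph

variable {V : Type*} [Fintype V] [DecidableEq V] (G : SimpleGraph V) [DecidableRel G.Adj]

theorem lapMatrix_map_intCast : (G.lapMatrix ℤ).map (Int.cast : ℤ → ℝ) = G.lapMatrix ℝ := by
  ext i j
  simp only [lapMatrix, degMatrix, Matrix.map_apply, Matrix.sub_apply, Matrix.diagonal_apply,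
    adjMatrix_apply]
  push_cast
  rfl

theorem exists_int_eigenvector {k : ℤ} {x : V → ℝ} (hx : x ≠ 0)
    (hL : G.lapMatrix ℝ *ᵥ x = (k : ℝ) • x) {e : V → ℤ} (he : (fun i => (e i : ℝ)) ⬝ᵥ x = 0) :
    ∃ y : V → ℤ, G.lapMatrix ℤ *ᵥ y = k • y ∧ e ⬝ᵥ y = 0 ∧ ∃ i, Odd (y i) := by
  -- Stacking `e` under `L - k` imposes both conditions as one integer system.
  have hM : (Matrix.fromRows (G.lapMatrix ℤ - k • 1) (Matrix.of fun _ : Unit => e)).map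
      (Int.cast : ℤ → ℝ) *ᵥ x = 0 := by
    have e1 : (G.lapMatrix ℤ - k • (1 : Matrix V V ℤ)).map (Int.cast : ℤ → ℝ) =
        G.lapMatrix ℝ - (k : ℝ) • 1 := by
      rw [← lapMatrix_map_intCast]
      ext i j
      simp only [Matrix.map_apply, Matrix.sub_apply, Matrix.smul_apply, Matrix.one_apply,
        smul_eq_mul]
      push_cast
      rfl
    rw [Matrix.fromRows_map, Matrix.fromRows_mulVec, e1, Matrix.sub_mulVec, hL,
      Matrix.smul_mulVec, Matrix.one_mulVec, sub_self]
    funext i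
    rcases i with i | i
    · rfl
    · exact he
  obtain ⟨y, hy, hy0⟩ := Matrix.exists_int_mulVec_eq_zero _ hx hM
  obtain ⟨c, z, hc, rfl, hodd⟩ := exists_odd_primitive hy
  rw [Matrix.mulVec_smul] at hy0
  replace hy0 := (smul_eq_zero.1 hy0).resolve_left hc
  rw [Matrix.fromRows_mulVec, Matrix.sub_mulVec, Matrix.smul_mulVec, Matrix.one_mulVec] at hy0
  refine ⟨z, sub_eq_zero.1 (funext fun i => congrFun hy0 (Sum.inl i)), ?_, hodd⟩
  exact congrFun hy0 (Sum.inr ())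

theorem sum_lapMatrix_mulVec (y : V → ℤ) : ∑ i, (G.lapMatrix ℤ *ᵥ y) i = 0 := by
  have h : (fun _ => (1 : ℤ)) ⬝ᵥ (G.lapMatrix ℤ *ᵥ y) = 0 := by
    rw [Matrix.dotProduct_mulVec, ← Matrix.mulVec_transpose, (G.isSymm_lapMatrix (R := ℤ)).eq,
      lapMatrix_mulVec_const_eq_zero, zero_dotProduct]
  simpa [dotProduct] using h

theorem sum_eq_zero_of_lapMatrix_mulVec {k : ℤ} (hk : k ≠ 0) {y : V → ℤ}
    (h : G.lapMatrix ℤ *ᵥ y = k • y) : ∑ i, y i = 0 := by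
  have h1 := G.sum_lapMatrix_mulVec y
  simp only [h, Pi.smul_apply, smul_eq_mul, ← Finset.mul_sum] at h1
  exact (mul_eq_zero.1 h1).resolve_left hk

theorem two_pow_succ_dvd_numSpanningTrees {v : V} {z w : V → ℤ} {t : ℕ} (ht : 1 ≤ t)
    (hz : G.lapMatrix ℤ *ᵥ z = (2 : ℤ) ^ t • w) (hv : z v = 0) {i : V} (hi : Odd (z i))
    (hwz : Even (w ⬝ᵥ z)) : 2 ^ (t + 1) ∣ G.numSpanningTrees := by
  have hiv : i ≠ v := by
    rintro rfl
    simp [hv] at hi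
  have hres (f : V → ℤ) : ∑ j : {u // u ≠ v}, f j * z j = ∑ j, f j * z j := by
    rw [← Fintype.sum_subtype_add_sum_subtype (· ≠ v) (fun j => f j * z j), left_eq_add]
    refine Finset.sum_eq_zero fun j _ => ?_
    rw [not_not.1 j.2, hv, mul_zero]
  have h := ((G.isSymm_lapMatrix (R := ℤ)).submatrix ((↑) : {u // u ≠ v} → V)).two_pow_succ_dvd_det
    (z := fun j => z j) (w := fun j => w j) (i := ⟨i, hiv⟩) ht ?_ hi ?_
  · rw [det_reduced_lapMatrix] at h
    exact_mod_cast h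
  · funext j
    exact (hres (G.lapMatrix ℤ j)).trans (congrFun hz j)
  · exact (congrArg Even (hres w)).mpr hwz

theorem even_sum_mul_self {n : Type*} [Fintype n] {y : n → ℤ} (h : ∑ i, y i = 0) :
    Even (∑ i, y i * y i) := by
  have : ∑ i, y i * y i = ∑ i, y i * (y i - 1) := by
    simp [mul_sub, h]
  rw [this]
  exact Finset.even_sum _ fun i _ => Int.even_mul_pred_self _

end SimpleGraph

theorem mainTheorem7 {V : Type*} [Fintype V] [DecidableEq V] (G : SimpleGraph V)
    [DecidableRel G.Adj] (hG : G.Connected) :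
    (∀ t s : ℕ, Odd (Fintype.card V) → Odd s → G.numSpanningTrees = 2 ^ t * s →
      ∀ k : ℤ, k ≠ 0 → (2 : ℤ) ^ max 1 t ∣ k →
        ¬ Module.End.HasEigenvalue G.laplacianEnd (k : ℝ)) ∧
    (∀ (k s : ℤ) (t : ℕ), 1 ≤ t → Odd s → k = 2 ^ t * s →
      2 ≤ Module.finrank ℝ (Module.End.eigenspace G.laplacianEnd (k : ℝ)) →
        2 ^ (t + 1) ∣ G.numSpanningTrees) := by
  obtain ⟨v⟩ := hG.nonempty
  constructor
  · rintro t s hn hs hτ k hk ⟨c, hc⟩ hev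
    obtain ⟨x, hx⟩ := hev.exists_hasEigenvector
    obtain ⟨y, hy, -, i, hi⟩ := G.exists_int_eigenvector (e := 0) hx.2
      (by simpa [SimpleGraph.laplacianEnd] using hx.apply_eq_smul) (by simp)
    have hsum := G.sum_eq_zero_of_lapMatrix_mulVec hk hy
    -- Otherwise `0 = ∑ y j ≡ n * y v` modulo 2 with `n` odd, so `y v`, and then every entry, is
    -- even.
    have hodd : ∃ j, Odd (y j - y v) := by
      by_contra! hall
      simp only [Int.not_odd_iff_even] at hall
      have h1 : Even (∑ j, (y j - y v)) := Finset.even_sum _ fun j _ => hall j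
      rw [Finset.sum_sub_distrib, hsum, Finset.sum_const, zero_sub, even_neg, nsmul_eq_mul,
        Finset.card_univ, Int.even_mul, Int.even_coe_nat] at h1
      have h2 := h1.resolve_left (Nat.not_even_iff_odd.2 hn)
      exact Int.not_even_iff_odd.2 hi (by simpa using (hall i).add h2)
    obtain ⟨j, hj⟩ := hodd
    have hdvd := G.two_pow_succ_dvd_numSpanningTrees (v := v) (z := fun j => y j - y v)
      (w := c • y) (t := max 1 t) (le_max_left _ _) ?_ (sub_self _) hj ?_
    · have h2 := (pow_dvd_pow 2 (Nat.succ_le_succ (le_max_right 1 t))).trans hdvd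
      rw [hτ, pow_succ] at h2
      exact Nat.not_even_iff_odd.2 hs
        (even_iff_two_dvd.2 (Nat.dvd_of_mul_dvd_mul_left (by positivity) h2))
    · have : (fun j => y j - y v) = y - y v • fun _ => (1 : ℤ) := by
        funext j
        simp
      rw [this, Matrix.mulVec_sub, Matrix.mulVec_smul, G.lapMatrix_mulVec_const_eq_zero, smul_zero,
        sub_zero, hy, hc, mul_smul]
    · have : (c • y) ⬝ᵥ (fun j => y j - y v) = c * ∑ j, y j * y j := by
        rw [smul_dotProduct, smul_eq_mul]
        simp [dotProduct, mul_sub, ← Finset.sum_mul, hsum]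
      rw [this]
      exact (SimpleGraph.even_sum_mul_self hsum).mul_left c
  · intro k s t ht hs hk hrank
    have hk0 : k ≠ 0 := by
      rw [hk]
      exact mul_ne_zero (by positivity) (by rintro rfl; simp at hs)
    let φ : Module.End.eigenspace G.laplacianEnd (k : ℝ) →ₗ[ℝ] ℝ :=
      (LinearMap.proj v : (V → ℝ) →ₗ[ℝ] ℝ) ∘ₗ Submodule.subtype _
    -- Evaluation at `v` has a nonzero kernel on a space of dimension at least 2.
    obtain ⟨x, hxφ, hx0⟩ := Submodule.exists_mem_ne_zero_of_ne_bot
      (LinearMap.ker_ne_bot_of_finrank_lt (f := φ) (by rw [Module.finrank_self]; omega))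
    obtain ⟨y, hy, hyv, i, hi⟩ := G.exists_int_eigenvector (k := k) (x := x.1) (e := Pi.single v 1)
      (fun h => hx0 (Subtype.ext h))
      (by simpa [SimpleGraph.laplacianEnd] using Module.End.mem_eigenspace_iff.1 x.2)
      (by
        have : (fun i => ((Pi.single v 1 : V → ℤ) i : ℝ)) = Pi.single v 1 := by
          funext i
          simp [Pi.single_apply, apply_ite]
        rw [this, single_one_dotProduct]
        exact hxφ)
    rw [single_one_dotProduct] at hyv
    have hsum := G.sum_eq_zero_of_lapMatrix_mulVec hk0 hy
    refine G.two_pow_succ_dvd_numSpanningTrees (v := v) (z := y) (w := s • y) ht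
      (by rw [hy, hk, mul_smul]) hyv hi ?_
    rw [smul_dotProduct, smul_eq_mul]
    exact (SimpleGraph.even_sum_mul_self hsum).mul_left s
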